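/- An orthogonal array $\mathrm{OA}(m,n)$ is an $m\times n^2$ array with entries from an $n$-element set such that, for any two of its rows, the $n^2$ ordered pairs formed by these two rows (one pair for each column) are pairwise distinct. An $\mathrm{OA}(n+1,n)$ is called a full orthogonal array. Let $m$ and $n$ be positive integers, with $m\le 2$ in the case $n=1$, and let $\delta=n-m+1$. If $$n>\tfrac{8}{3}\delta^3-\tfrac{16}{3}\delta^2+2\delta+\tfrac{2}{3},$$ then every orthogonal array $\mathrm{OA}(m,n)$ can be extended to a full orthogonal array; that is, $m\le n+1$, and one can append $n+1-m=\delta$ rows with entries from the same $n$-element set so that the result is an $\mathrm{OA}(n+1,n)$. -/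

import Mathlib

/-- An array with `m` rows and `n ^ 2` columns and entries in `S` is an orthogonal array
`OA(m, n)` if `S` has exactly `n` elements and, for any two rows, the `n ^ 2` ordered pairs
formed by these two rows (one pair for each column) are pairwise distinct. -/
def IsOrthogonalArray {S : Type*} [Fintype S] (m n : ℕ)
    (A : Matrix (Fin m) (Fin (n ^ 2)) S) : Prop :=
  Fintype.card S = n ∧
    ∀ i j : Fin m, i ≠ j → Function.Injective fun c : Fin (n ^ 2) => (A i c, A j c)

/-- An orthogonal array `OA(n + 1, n)` is a full orthogonal array. -/
def IsFullOrthogonalArray {S : Type*} [Fintype S] (n : ℕ)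
    (B : Matrix (Fin (n + 1)) (Fin (n ^ 2)) S) : Prop :=
  IsOrthogonalArray (n + 1) n B

/-- The array `A` with `m` rows can be extended to a full orthogonal array: `m ≤ n + 1`, and there
is a full orthogonal array over the same set of entries whose first `m` rows are those of `A`. -/
def ExtendsToFull {S : Type*} [Fintype S] (m n : ℕ)
    (A : Matrix (Fin m) (Fin (n ^ 2)) S) : Prop :=
  ∃ h : m ≤ n + 1, ∃ B : Matrix (Fin (n + 1)) (Fin (n ^ 2)) S,
    IsFullOrthogonalArray n B ∧ ∀ (i : Fin m) (c : Fin (n ^ 2)), B (Fin.castLE h i) c = A i c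

/-! Put `d = n - m`, so `δ = d + 1`, and join two columns when they differ in every row. A further
row amounts to a partition of the columns into `n` cliques of size `n` of this graph. The graph has
the parameters of the collinearity graph of a net with `d + 1` parallel classes: degree `(d + 1)(n -
1)`, `n - 2 + d(d - 1)` common neighbours for adjacent columns, at most `d(d + 1)` for nonadjacent
ones. The task is to recover the lines of such a net.

When `n` is large against `d ^ 3`, independent sets inside a neighbourhood are small
(`card_claw_le`), and each neighbourhood is covered by at most `p + 1` large maximal cliques, where
`p = ⌊4d/3⌋` (`exists_grandClique_cover`). Two distinct large cliques share at most one vertex.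
Since no clique exceeds `n`, the degree then forces exactly `d + 1` of them through every vertex,
all of size `n` (`exists_net_lines`).

Fix such a line `C`. A point off `C` has exactly `d` neighbours on `C`, so exactly one of its `d +
1` lines misses `C`. Hence the lines equal or disjoint to `C` partition the columns and define a row
(`exists_row_of_lines`). Appending it lowers `d` and preserves the bound, so induction finishes; at
`d = 0` one last row is still added. -/

namespace SimpleGraph

/-! ### Claws and grand cliques. -/

variable {V : Type*} [Fintype V] [DecidableEq V] (G : SimpleGraph V) [DecidableRel G.Adj]

/-- Nonadjacent distinct vertices with a common neighbour `x` have at most `q` common neighbours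
besides `x`, when nonadjacent vertices have at most `q + 1` common neighbours. -/
theorem card_common_le_of_not_mem {q : ℕ}
    (hμ : ∀ x y, x ≠ y → ¬ G.Adj x y →
      (G.neighborFinset x ∩ G.neighborFinset y).card ≤ q + 1)
    {x y z : V} (hy : G.Adj x y) (hz : G.Adj x z) (hne : y ≠ z) (hyz : ¬ G.Adj y z)
    (U : Finset V) (hx : x ∉ U) (hU : ∀ u ∈ U, G.Adj y u ∧ G.Adj z u) : U.card ≤ q := by
  have h1 : (insert x U).card ≤ q + 1 := by
    refine le_trans (Finset.card_le_card ?_) (hμ y z hne hyz)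
    intro u hu
    rw [Finset.mem_insert] at hu
    simp only [Finset.mem_inter, mem_neighborFinset]
    rcases hu with rfl | hu
    · exact ⟨hy.symm, hz.symm⟩
    · exact hU u hu
  rw [Finset.card_insert_of_notMem hx] at h1
  omega

/-- Bonferroni's inequality for an independent set of neighbours of a vertex. -/
theorem card_claw_le {k l q : ℕ} (hk : ∀ x, G.degree x = k)
    (hl : ∀ x y, G.Adj x y → (G.neighborFinset x ∩ G.neighborFinset y).card = l)
    (hμ : ∀ x y, x ≠ y → ¬ G.Adj x y →
      (G.neighborFinset x ∩ G.neighborFinset y).card ≤ q + 1)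
    {x : V} (T : Finset V) (hT : ∀ y ∈ T, G.Adj x y)
    (hind : ∀ y ∈ T, ∀ z ∈ T, ¬ G.Adj y z) :
    2 * T.card * (l + 1) ≤ 2 * k + T.card * (T.card - 1) * q := by
  set B : V → Finset V := fun y => insert y (G.neighborFinset x ∩ G.neighborFinset y) with hB
  have hBcard : ∀ y, G.Adj x y → (B y).card = l + 1 := by
    intro y hy
    rw [hB, Finset.card_insert_of_notMem (by simp), hl x y hy]
  -- The sets `B y` have size `l + 1` and overlap pairwise in at most `q` points. Adding them one at
  -- a time, the new set meets the union of the `t` earlier ones in at most `t * q` points.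
  have key : 2 * T.card * (l + 1) ≤ 2 * (T.biUnion B).card + T.card * (T.card - 1) * q := by
    induction T using Finset.induction_on with
    | empty => simp
    | insert y T hyT ih =>
      have ih' := ih (fun y hy => hT y (Finset.mem_insert_of_mem hy))
        (fun y hy z hz => hind y (Finset.mem_insert_of_mem hy) z (Finset.mem_insert_of_mem hz))
      have hxy := hT y (Finset.mem_insert_self _ _)
      have hint : (B y ∩ T.biUnion B).card ≤ T.card * q := by
        rw [Finset.inter_biUnion]
        refine Finset.card_biUnion_le_card_mul _ _ _ ?_
        intro z hz
        have hne : y ≠ z := fun h => hyT (h ▸ hz)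
        have hxz := hT z (Finset.mem_insert_of_mem hz)
        have hyz := hind y (Finset.mem_insert_self _ _) z (Finset.mem_insert_of_mem hz)
        refine G.card_common_le_of_not_mem hμ hxy hxz hne hyz _ ?_ ?_
        · simp [hB, hxy.ne]
        · intro u hu
          simp only [hB, Finset.mem_inter, Finset.mem_insert, mem_neighborFinset] at hu
          rcases hu with ⟨rfl | h1, h2⟩
          · rcases h2 with h | h
            · exact absurd h hne
            · exact absurd h.2.symm hyz
          · rcases h2 with rfl | h2
            · exact absurd h1.2 hyz
            · exact ⟨h1.2, h2.2⟩
      have hun := Finset.card_union_add_card_inter (B y) (T.biUnion B)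
      rw [Finset.biUnion_insert, Finset.card_insert_of_notMem hyT]
      rw [hBcard y hxy] at hun
      clear ih hT hind
      generalize T.card = t at ih' hint ⊢
      rcases t with _ | t
      · simp only [zero_mul, Nat.le_zero] at hint ⊢
        omega
      · simp only [Nat.add_sub_cancel] at ih' ⊢
        nlinarith
  have hsub : (T.biUnion B).card ≤ k := by
    rw [← hk x, ← card_neighborFinset_eq_degree]
    refine Finset.card_le_card ?_
    intro u hu
    simp only [hB, Finset.mem_biUnion, Finset.mem_insert, Finset.mem_inter] at hu
    obtain ⟨y, hy, rfl | h⟩ := hu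
    · simpa using hT u hy
    · exact h.1
  omega

/-- A maximal clique with at least `b` vertices. -/
structure IsGrandClique (b : ℕ) (M : Finset V) : Prop where
  adj : ∀ u ∈ M, ∀ v ∈ M, u ≠ v → G.Adj u v
  card : b ≤ M.card
  maximal : ∀ v, (∀ u ∈ M, u ≠ v → G.Adj u v) → v ∈ M

-- If some `u ∈ M` and `v ∈ N` were nonadjacent, `M ∩ N` would consist of common neighbours of `u`
-- and `v`, and `M ∪ N` of `x`, `y` and their common neighbours. Then `2 * b ≤ |M| + |N| ≤ l + q +
-- 3`. So `M ∪ N` is a clique, and maximality gives equality.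
variable {G} in
theorem IsGrandClique.eq_of_mem {b l q : ℕ}
    (hl : ∀ x y, G.Adj x y → (G.neighborFinset x ∩ G.neighborFinset y).card = l)
    (hμ : ∀ x y, x ≠ y → ¬ G.Adj x y →
      (G.neighborFinset x ∩ G.neighborFinset y).card ≤ q + 1)
    (hb : l + q + 3 < 2 * b) {M N : Finset V} (hM : G.IsGrandClique b M)
    (hN : G.IsGrandClique b N) {x y : V} (hxy : x ≠ y) (hxM : x ∈ M) (hyM : y ∈ M)
    (hxN : x ∈ N) (hyN : y ∈ N) : M = N := by
  have hall : ∀ u ∈ M, ∀ v ∈ N, u ≠ v → G.Adj u v := by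
    intro u hu v hv huv
    by_contra hadj
    have huN : u ∉ N := fun h => hadj (hN.adj u h v hv huv)
    have hvM : v ∉ M := fun h => hadj (hM.adj u hu v h huv)
    have h1 : (M ∩ N).card ≤ q + 1 := by
      refine le_trans (Finset.card_le_card ?_) (hμ u v huv hadj)
      intro w hw
      rw [Finset.mem_inter] at hw
      simp only [Finset.mem_inter, mem_neighborFinset]
      exact ⟨hM.adj u hu w hw.1 (fun h => huN (h ▸ hw.2)),
        hN.adj v hv w hw.2 (fun h => hvM (h ▸ hw.1))⟩
    have h2 : (M ∪ N).card ≤ l + 2 := by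
      rw [← hl x y (hM.adj x hxM y hyM hxy)]
      have : M ∪ N ⊆ (G.neighborFinset x ∩ G.neighborFinset y) ∪ {x, y} := by
        intro w hw
        simp only [Finset.mem_union, Finset.mem_inter, mem_neighborFinset, Finset.mem_insert,
          Finset.mem_singleton] at hw ⊢
        by_cases hwx : w = x
        · exact Or.inr (Or.inl hwx)
        by_cases hwy : w = y
        · exact Or.inr (Or.inr hwy)
        left
        rcases hw with hw | hw
        · exact ⟨hM.adj x hxM w hw (Ne.symm hwx), hM.adj y hyM w hw (Ne.symm hwy)⟩
        · exact ⟨hN.adj x hxN w hw (Ne.symm hwx), hN.adj y hyN w hw (Ne.symm hwy)⟩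
      exact (Finset.card_le_card this).trans
        ((Finset.card_union_le _ _).trans (Nat.add_le_add_left Finset.card_le_two _))
    have h3 := Finset.card_union_add_card_inter M N
    have h4 := hM.card
    have h5 := hN.card
    omega
  refine Finset.Subset.antisymm (fun u hu => hN.maximal u fun v hv hvu => ?_)
    (fun v hv => hM.maximal v fun u hu huv => hall u hu v hv huv)
  exact (hall u hu v hv (Ne.symm hvu)).symm

/-- The neighbourhood of a vertex is covered by few grand cliques. -/
theorem exists_grandClique_cover {l q p : ℕ}
    (hl : ∀ x y, G.Adj x y → (G.neighborFinset x ∩ G.neighborFinset y).card = l)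
    (hμ : ∀ x y, x ≠ y → ¬ G.Adj x y →
      (G.neighborFinset x ∩ G.neighborFinset y).card ≤ q + 1)
    (hclaw : ∀ (x : V) (T : Finset V), (∀ y ∈ T, G.Adj x y) →
      (∀ y ∈ T, ∀ z ∈ T, ¬ G.Adj y z) → T.card ≤ p + 1)
    (hlq : (2 * p + 1) * q < l + 1) (x : V) :
    ∃ F : Finset (Finset V), F.card ≤ p + 1 ∧
      (∀ M ∈ F, G.IsGrandClique (l + 2 - p * q) M ∧ x ∈ M) ∧
      ∀ w, G.Adj x w → ∃ M ∈ F, w ∈ M := by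
  obtain ⟨S, hS, hSmax⟩ := Finset.exists_max_image
    (Finset.univ.filter fun T : Finset V =>
      (∀ y ∈ T, G.Adj x y) ∧ ∀ y ∈ T, ∀ z ∈ T, ¬ G.Adj y z) Finset.card ⟨∅, by simp⟩
  simp only [Finset.mem_filter, Finset.mem_univ, true_and] at hS hSmax
  obtain ⟨hSx, hSind⟩ := hS
  have hScard := hclaw x S hSx hSind
  -- `S` is a largest independent set in the neighbourhood of `x`; `C y` collects the neighbours of
  -- `x` that see no member of `S` other than possibly `y`, and equal or see `y`.
  set C : V → Finset V := fun y => (G.neighborFinset x).filter fun z =>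
    (z = y ∨ G.Adj y z) ∧ ∀ y' ∈ S, y' ≠ y → ¬ G.Adj y' z with hC
  have hCmem : ∀ y z, z ∈ C y ↔ G.Adj x z ∧ (z = y ∨ G.Adj y z) ∧
      ∀ y' ∈ S, y' ≠ y → ¬ G.Adj y' z := by
    intro y z; simp [hC]
  have hself : ∀ y ∈ S, y ∈ C y := fun y hy =>
    (hCmem y y).2 ⟨hSx y hy, Or.inl rfl, fun y' hy' _ => hSind y' hy' y hy⟩
  -- Two nonadjacent members of `C y` could replace `y` in `S`, giving a larger independent set.
  have hCadj : ∀ y ∈ S, ∀ u ∈ C y, ∀ v ∈ C y, u ≠ v → G.Adj u v := by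
    intro y hy u hu v hv huv
    rw [hCmem] at hu hv
    by_contra hadj
    have huy : u ≠ y := by
      rintro rfl
      exact hadj (hv.2.1.resolve_left (Ne.symm huv))
    have hvy : v ≠ y := by
      rintro rfl
      exact hadj (hu.2.1.resolve_left huv).symm
    have hyu := hu.2.1.resolve_left huy
    have hyv := hv.2.1.resolve_left hvy
    have huS : u ∉ S := fun h => hSind y hy u h hyu
    have hvS : v ∉ S := fun h => hSind y hy v h hyv
    have := hSmax (insert u (insert v (S.erase y))) (by
      constructor
      · intro z hz
        simp only [Finset.mem_insert, Finset.mem_erase] at hz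
        rcases hz with rfl | rfl | hz
        · exact hu.1
        · exact hv.1
        · exact hSx z hz.2
      · intro a ha b hb
        simp only [Finset.mem_insert, Finset.mem_erase] at ha hb
        rcases ha with rfl | rfl | ha <;> rcases hb with rfl | rfl | hb
        · exact G.loopless.irrefl _
        · exact hadj
        · exact fun h => hu.2.2 b hb.2 hb.1 h.symm
        · exact fun h => hadj h.symm
        · exact G.loopless.irrefl _
        · exact fun h => hv.2.2 b hb.2 hb.1 h.symm
        · exact hu.2.2 a ha.2 ha.1
        · exact hv.2.2 a ha.2 ha.1
        · exact hSind a ha.2 b hb.2)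
    rw [Finset.card_insert_of_notMem (by simp [huv, huS]),
      Finset.card_insert_of_notMem (by simp [hvS]), Finset.card_erase_of_mem hy] at this
    have := Finset.card_pos.2 ⟨y, hy⟩
    omega
  have hCcard : ∀ y ∈ S, l + 1 ≤ (C y).card + (S.card - 1) * q := by
    intro y hy
    have hsub : insert y (G.neighborFinset x ∩ G.neighborFinset y) ⊆
        C y ∪ (S.erase y).biUnion
          fun y' => (G.neighborFinset x ∩ G.neighborFinset y) ∩ G.neighborFinset y' := by
      intro z hz
      rw [Finset.mem_union]
      by_cases hzC : z ∈ C y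
      · exact Or.inl hzC
      right
      rw [Finset.mem_insert] at hz
      have hz' := hz.resolve_left (by rintro rfl; exact hzC (hself _ hy))
      rw [hCmem] at hzC
      have hz'' := hz'
      simp only [Finset.mem_inter, mem_neighborFinset] at hz''
      have : ∃ y' ∈ S, y' ≠ y ∧ G.Adj y' z := by
        by_contra hcon
        push Not at hcon
        exact hzC ⟨hz''.1, Or.inr hz''.2, hcon⟩
      obtain ⟨y', hy', hne, hadj⟩ := this
      rw [Finset.mem_biUnion]
      exact ⟨y', Finset.mem_erase.2 ⟨hne, hy'⟩, Finset.mem_inter.2 ⟨hz', by simpa using hadj⟩⟩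
    have h1 := Finset.card_le_card hsub
    rw [Finset.card_insert_of_notMem (by simp), hl x y (hSx y hy)] at h1
    refine h1.trans ((Finset.card_union_le _ _).trans (Nat.add_le_add_left ?_ _))
    rw [← Finset.card_erase_of_mem hy]
    refine Finset.card_biUnion_le_card_mul _ _ _ ?_
    intro y' hy'
    rw [Finset.mem_erase] at hy'
    refine G.card_common_le_of_not_mem hμ (hSx y hy) (hSx y' hy'.2) (Ne.symm hy'.1)
      (hSind y hy y' hy'.2) _ (by simp) ?_
    intro u hu
    simp only [Finset.mem_inter, mem_neighborFinset] at hu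
    exact ⟨hu.1.2, hu.2⟩
  have hCbig : ∀ y ∈ S, S.card * q < (C y).card := by
    intro y hy
    have h1 := hCcard y hy
    have h2 := Finset.card_pos.2 ⟨y, hy⟩
    obtain ⟨t, ht⟩ : ∃ t, S.card = t + 1 := ⟨S.card - 1, by omega⟩
    rw [ht] at h1 hScard ⊢
    have : t * q ≤ p * q := Nat.mul_le_mul_right _ (by omega)
    simp only [Nat.add_sub_cancel] at h1
    nlinarith
  -- Otherwise every `C y` has a non-neighbour of `w`, and a transversal of the `C y` that is
  -- independent and avoids the neighbours of `w` would, together with `w`, exceed `S`.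
  have hcover : ∀ w, G.Adj x w → ∃ y ∈ S, ∀ z ∈ C y, z ≠ w → G.Adj z w := by
    intro w hw
    by_contra hcon
    push Not at hcon
    have hwC : ∀ y ∈ S, w ∉ C y := by
      intro y hy hwy
      obtain ⟨z, hz, hzw, hadj⟩ := hcon y hy
      exact hadj (hCadj y hy z hz w hwy hzw)
    -- The transversal is chosen greedily: `w` and each earlier choice exclude at most `q` vertices
    -- of `C y`, hence at most `|S| * q < |C y|` in all.
    have hchoice : ∀ T : Finset V, T ⊆ S → ∃ f : V → V,
        (∀ y ∈ T, f y ∈ C y ∧ ¬ G.Adj (f y) w) ∧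
        ∀ y ∈ T, ∀ y' ∈ T, ¬ G.Adj (f y) (f y') := by
      intro T
      induction T using Finset.induction_on with
      | empty => intro _; exact ⟨id, by simp, by simp⟩
      | insert y T hyT ih =>
        intro hTS
        obtain ⟨f, hf1, hf2⟩ := ih ((Finset.subset_insert _ _).trans hTS)
        have hyS : y ∈ S := hTS (Finset.mem_insert_self _ _)
        have hTS' : ∀ z ∈ T, z ∈ S := fun z hz => hTS (Finset.mem_insert_of_mem hz)
        have h1 : (C y ∩ G.neighborFinset w).card ≤ q := by
          obtain ⟨z, hz, hzw, hadj⟩ := hcon y hyS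
          refine G.card_common_le_of_not_mem hμ ((hCmem y z).1 hz).1 hw hzw hadj _
            (by simp [hC]) ?_
          intro u hu
          simp only [Finset.mem_inter, mem_neighborFinset] at hu
          refine ⟨hCadj y hyS z hz u hu.1 ?_, hu.2⟩
          rintro rfl
          exact hadj hu.2.symm
        have h2 : (T.biUnion fun y' => C y ∩ G.neighborFinset (f y')).card ≤ T.card * q := by
          refine Finset.card_biUnion_le_card_mul _ _ _ ?_
          intro y' hy'
          have hne : y ≠ y' := fun h => hyT (h ▸ hy')
          have hfy' := (hCmem _ _).1 (hf1 y' hy').1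
          have hnadj : ¬ G.Adj y (f y') := hfy'.2.2 y hyS hne
          have hney : y ≠ f y' := by
            intro h
            rcases hfy'.2.1 with h' | h'
            · exact hne (h.trans h')
            · exact hSind y' (hTS' _ hy') y hyS (h ▸ h')
          refine G.card_common_le_of_not_mem hμ (hSx y hyS) hfy'.1 hney hnadj _
            (by simp [hC]) ?_
          intro u hu
          simp only [Finset.mem_inter, mem_neighborFinset] at hu
          refine ⟨hCadj y hyS y (hself y hyS) u hu.1 ?_, hu.2⟩
          rintro rfl
          exact hnadj hu.2.symm
        have h3 : (C y ∩ G.neighborFinset w ∪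
            T.biUnion fun y' => C y ∩ G.neighborFinset (f y')).card < (C y).card := by
          have h4 := Finset.card_le_card hTS
          rw [Finset.card_insert_of_notMem hyT] at h4
          have h5 := hCbig y hyS
          have h6 := Nat.mul_le_mul_right q h4
          have h7 := Finset.card_union_le (C y ∩ G.neighborFinset w)
            (T.biUnion fun y' => C y ∩ G.neighborFinset (f y'))
          nlinarith
        obtain ⟨z, hz, hznot⟩ := Finset.exists_mem_notMem_of_card_lt_card h3
        simp only [Finset.mem_union, Finset.mem_inter, Finset.mem_biUnion, mem_neighborFinset,
          not_or, not_exists, not_and] at hznot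
        refine ⟨Function.update f y z, ?_, ?_⟩
        · intro y' hy'
          rcases Finset.mem_insert.1 hy' with rfl | hy'
          · simp only [Function.update_self]
            exact ⟨hz, fun h => hznot.1 hz h.symm⟩
          · rw [Function.update_of_ne (fun h : y' = y => hyT (h ▸ hy'))]
            exact hf1 y' hy'
        · intro a ha b hb
          by_cases hay : a = y <;> by_cases hby : b = y
          · subst hay; subst hby; exact G.loopless.irrefl _
          · subst hay
            rw [Function.update_self, Function.update_of_ne hby]
            exact fun h => hznot.2 b ((Finset.mem_insert.1 hb).resolve_left hby) hz h.symm
          · subst hby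
            rw [Function.update_self, Function.update_of_ne hay]
            exact hznot.2 a ((Finset.mem_insert.1 ha).resolve_left hay) hz
          · rw [Function.update_of_ne hay, Function.update_of_ne hby]
            exact hf2 a ((Finset.mem_insert.1 ha).resolve_left hay) b
              ((Finset.mem_insert.1 hb).resolve_left hby)
    obtain ⟨f, hf1, hf2⟩ := hchoice S (Finset.Subset.refl _)
    have hinj : Set.InjOn f S := by
      intro a ha b hb hab
      by_contra hne
      have h1 := (hCmem _ _).1 (hf1 a ha).1
      have h2 := (hCmem _ _).1 (hf1 b hb).1
      rw [← hab] at h2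
      rcases h1.2.1 with h | h
      · rcases h2.2.1 with h' | h'
        · exact hne (h.symm.trans h')
        · rw [h] at h'
          exact hSind b hb a ha h'
      · exact h2.2.2 a ha hne h
    have := hSmax (insert w (S.image f)) (by
      constructor
      · intro z hz
        simp only [Finset.mem_insert, Finset.mem_image] at hz
        rcases hz with rfl | ⟨y, hy, rfl⟩
        · exact hw
        · exact ((hCmem _ _).1 (hf1 y hy).1).1
      · intro a ha b hb
        simp only [Finset.mem_insert, Finset.mem_image] at ha hb
        rcases ha with rfl | ⟨a, ha, rfl⟩ <;> rcases hb with rfl | ⟨b, hb, rfl⟩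
        · exact G.loopless.irrefl _
        · exact fun h => (hf1 b hb).2 h.symm
        · exact (hf1 a ha).2
        · exact hf2 a ha b hb)
    rw [Finset.card_insert_of_notMem, Finset.card_image_of_injOn hinj] at this
    · omega
    · simp only [Finset.mem_image, not_exists, not_and]
      rintro y hy rfl
      exact hwC y hy (hf1 y hy).1
  set M : V → Finset V := fun y => insert x ((G.neighborFinset x).filter fun w =>
    ∀ z ∈ C y, z ≠ w → G.Adj z w) with hM
  have hMmem : ∀ y w, w ∈ M y ↔ w = x ∨ G.Adj x w ∧ ∀ z ∈ C y, z ≠ w → G.Adj z w := by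
    intro y w; simp [hM]
  have hCM : ∀ y ∈ S, ∀ z ∈ C y, z ∈ M y := fun y hy z hz =>
    (hMmem y z).2 (Or.inr ⟨((hCmem _ _).1 hz).1, fun u hu huz => hCadj y hy u hu z hz huz⟩)
  refine ⟨S.image M, Finset.card_image_le.trans hScard, ?_, ?_⟩
  · intro N hN
    obtain ⟨y, hy, rfl⟩ := Finset.mem_image.1 hN
    refine ⟨⟨?_, ?_, ?_⟩, by simp [hM]⟩
    · intro u hu v hv huv
      rw [hMmem] at hu hv
      rcases hu with rfl | hu
      · rcases hv with rfl | hv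
        · exact absurd rfl huv
        · exact hv.1
      · rcases hv with rfl | hv
        · exact hu.1.symm
        -- Nonadjacent `u` and `v` would have all of `C y` as common neighbours besides `x`, but `|C
        -- y| > q`.
        · by_contra hadj
          have hu' : u ∉ C y := fun h => hadj (hv.2 u h huv)
          have hv' : v ∉ C y := fun h => hadj (hu.2 v h (Ne.symm huv)).symm
          have h1 := G.card_common_le_of_not_mem hμ hu.1 hv.1 huv hadj (C y) (by simp [hC])
            fun z hz => ⟨(hu.2 z hz (fun h => hu' (h ▸ hz))).symm,
              (hv.2 z hz (fun h => hv' (h ▸ hz))).symm⟩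
          have h2 := hCbig y hy
          have h3 : 1 * q ≤ S.card * q :=
            Nat.mul_le_mul_right _ (Finset.card_pos.2 ⟨y, hy⟩)
          omega
    · have h1 : (insert x (C y)).card ≤ (M y).card := by
        refine Finset.card_le_card (Finset.insert_subset_iff.2 ⟨by simp [hM], hCM y hy⟩)
      rw [Finset.card_insert_of_notMem (by simp [hC])] at h1
      have h2 := hCcard y hy
      have h3 : (S.card - 1) * q ≤ p * q := Nat.mul_le_mul_right _ (by omega)
      omega
    · intro v hv
      rw [hMmem]
      by_cases hvx : v = x
      · exact Or.inl hvx
      · exact Or.inr ⟨hv x (by simp [hM]) (Ne.symm hvx), fun z hz hzv => hv z (hCM y hy z hz) hzv⟩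
  · intro w hw
    obtain ⟨y, hy, h⟩ := hcover w hw
    exact ⟨M y, Finset.mem_image_of_mem _ hy, (hMmem y w).2 (Or.inr ⟨hw, h⟩)⟩

end SimpleGraph

/-! ### Grand cliques as the lines of a net. -/

namespace SimpleGraph

variable {V : Type*} [Fintype V] [DecidableEq V] (G : SimpleGraph V) [DecidableRel G.Adj]

/-- A pseudo net graph with suitable parameters is the point graph of a net: it has a system of
cliques of size `n`, two of which share at most one vertex, with `d + 1` of them through every
vertex. -/
theorem exists_net_lines {n d l p q : ℕ} (hn : 2 ≤ n)
    (hk : ∀ x, G.degree x = (d + 1) * (n - 1))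
    (hl : ∀ x y, G.Adj x y → (G.neighborFinset x ∩ G.neighborFinset y).card = l)
    (hμ : ∀ x y, x ≠ y → ¬ G.Adj x y →
      (G.neighborFinset x ∩ G.neighborFinset y).card ≤ q + 1)
    (hclique : ∀ M : Finset V, (∀ u ∈ M, ∀ v ∈ M, u ≠ v → G.Adj u v) → M.card ≤ n)
    (hlq : (2 * p + 1) * q < l + 1)
    (hclaw : 2 * ((d + 1) * (n - 1)) + (p + 2) * (p + 1) * q < 2 * (p + 2) * (l + 1))
    (hlines : (d + 1) * (n - 1) + (d + 2) * p ^ 2 < (d + 2) * (l + 1)) :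
    ∃ L : Finset (Finset V),
      (∀ M ∈ L, M.card = n ∧ ∀ u ∈ M, ∀ v ∈ M, u ≠ v → G.Adj u v) ∧
      (∀ M ∈ L, ∀ N ∈ L, ∀ u v, u ≠ v → u ∈ M → v ∈ M → u ∈ N → v ∈ N → M = N) ∧
      (∀ u v, G.Adj u v → ∃ M ∈ L, u ∈ M ∧ v ∈ M) ∧
      ∀ x, (L.filter (x ∈ ·)).card = d + 1 := by
  classical
  have hclaw' : ∀ (x : V) (T : Finset V), (∀ y ∈ T, G.Adj x y) →
      (∀ y ∈ T, ∀ z ∈ T, ¬ G.Adj y z) → T.card ≤ p + 1 := by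
    intro x T hT hind
    by_contra hcon
    obtain ⟨U, hU, hUc⟩ := Finset.exists_subset_card_eq (show p + 2 ≤ T.card by omega)
    have := G.card_claw_le hk hl hμ U (fun y hy => hT y (hU hy))
      (fun y hy z hz => hind y (hU hy) z (hU hz))
    rw [hUc] at this
    rw [show p + 2 - 1 = p + 1 by omega] at this
    omega
  have hcov := G.exists_grandClique_cover hl hμ hclaw' hlq
  set b := l + 2 - p * q with hb
  have hpq : 2 * (p * q) + q ≤ l := by nlinarith
  -- This is the size threshold for `IsGrandClique.eq_of_mem`; by `hpq` the subtraction in `b` does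
  -- not truncate.
  have hb2 : l + q + 3 < 2 * b := by omega
  set L : Finset (Finset V) := Finset.univ.filter (G.IsGrandClique b) with hL
  have hLmem : ∀ M, M ∈ L ↔ G.IsGrandClique b M := by simp [hL]
  have huniq : ∀ M ∈ L, ∀ N ∈ L, ∀ u v, u ≠ v → u ∈ M → v ∈ M → u ∈ N → v ∈ N → M = N :=
    fun M hM N hN u v huv h1 h2 h3 h4 =>
      ((hLmem M).1 hM).eq_of_mem hl hμ hb2 ((hLmem N).1 hN) huv h1 h2 h3 h4
  have hedge : ∀ u v, G.Adj u v → ∃ M ∈ L, u ∈ M ∧ v ∈ M := by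
    intro u v huv
    obtain ⟨F, -, hF, hF2⟩ := hcov u
    obtain ⟨M, hM, hv⟩ := hF2 v huv
    exact ⟨M, (hLmem M).2 (hF M hM).1, (hF M hM).2, hv⟩
  -- A grand clique through `x` shares a second vertex with some member of the cover, so it belongs
  -- to the cover.
  have hthrough : ∀ x, (L.filter (x ∈ ·)).card ≤ p + 1 := by
    intro x
    obtain ⟨F, hFc, hF, hF2⟩ := hcov x
    refine le_trans (Finset.card_le_card ?_) hFc
    intro M hM
    rw [Finset.mem_filter] at hM
    have hM' := (hLmem M).1 hM.1
    have hMc := hM'.card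
    obtain ⟨w, hw, hwx⟩ := Finset.exists_mem_ne (show 1 < M.card by omega) x
    obtain ⟨N, hN, hwN⟩ := hF2 w (hM'.adj x hM.2 w hw (Ne.symm hwx))
    rwa [huniq M hM.1 N ((hLmem N).2 (hF N hN).1) x w (Ne.symm hwx) hM.2 hw (hF N hN).2 hwN]
  -- A common neighbour of `y, y' ∈ M` outside `M` is determined by its lines to `y` and to `y'`,
  -- and each is one of at most `p` lines other than `M`.
  have hsize : ∀ M ∈ L, l + 2 ≤ M.card + p ^ 2 := by
    intro M hM
    have hM' := (hLmem M).1 hM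
    have hMc := hM'.card
    obtain ⟨y, hy, y', hy', hne⟩ := Finset.one_lt_card.1 (show 1 < M.card by omega)
    have hadj := hM'.adj y hy y' hy' hne
    choose! ln hln1 hln2 hln3 using hedge
    set Z := (G.neighborFinset y ∩ G.neighborFinset y') \ M with hZ
    have hZmem : ∀ z ∈ Z, G.Adj y z ∧ G.Adj y' z ∧ z ∉ M := by
      intro z hz
      simpa [hZ, and_assoc] using hz
    have hZc : Z.card ≤ p * p := by
      have hmaps : ∀ z ∈ Z, (ln y z, ln y' z) ∈
          (L.filter (y ∈ ·)).erase M ×ˢ (L.filter (y' ∈ ·)).erase M := by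
        intro z hz
        obtain ⟨h1, h2, h3⟩ := hZmem z hz
        simp only [Finset.mem_product, Finset.mem_erase, Finset.mem_filter]
        exact ⟨⟨fun h => h3 (h ▸ hln3 y z h1), hln1 y z h1, hln2 y z h1⟩,
          ⟨fun h => h3 (h ▸ hln3 y' z h2), hln1 y' z h2, hln2 y' z h2⟩⟩
      have hinj : Set.InjOn (fun z => (ln y z, ln y' z)) (Z : Set V) := by
        intro z hz w hw hzw
        obtain ⟨h1, h2, h3⟩ := hZmem z hz
        obtain ⟨h4, h5, h6⟩ := hZmem w hw
        simp only [Prod.mk.injEq] at hzw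
        by_contra hne'
        have e : ln y z = ln y' z := huniq _ (hln1 y z h1) _ (hln1 y' z h2) z w hne'
          (hln3 y z h1) (hzw.1 ▸ hln3 y w h4) (hln3 y' z h2) (hzw.2 ▸ hln3 y' w h5)
        have e' : M = ln y z := huniq M hM _ (hln1 y z h1) y y' hne hy hy' (hln2 y z h1)
          (e ▸ hln2 y' z h2)
        exact h3 (e' ▸ hln3 y z h1)
      refine (Finset.card_le_card_of_injOn _ hmaps hinj).trans ?_
      rw [Finset.card_product, Finset.card_erase_of_mem (Finset.mem_filter.2 ⟨hM, hy⟩),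
        Finset.card_erase_of_mem (Finset.mem_filter.2 ⟨hM, hy'⟩)]
      have h1 := hthrough y
      have h2 := hthrough y'
      exact Nat.mul_le_mul (by omega) (by omega)
    have hsub : G.neighborFinset y ∩ G.neighborFinset y' ⊆ ((M.erase y).erase y') ∪ Z := by
      intro z hz
      rw [Finset.mem_union]
      by_cases hzM : z ∈ M
      · simp only [Finset.mem_inter, mem_neighborFinset] at hz
        exact Or.inl (Finset.mem_erase.2 ⟨hz.2.ne', Finset.mem_erase.2 ⟨hz.1.ne', hzM⟩⟩)
      · exact Or.inr (Finset.mem_sdiff.2 ⟨hz, hzM⟩)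
    have h1 := (Finset.card_le_card hsub).trans (Finset.card_union_le _ _)
    rw [hl y y' hadj, Finset.card_erase_of_mem (Finset.mem_erase.2 ⟨hne.symm, hy'⟩),
      Finset.card_erase_of_mem hy] at h1
    rw [pow_two]
    omega
  have hsum : ∀ x, ∑ M ∈ L.filter (x ∈ ·), (M.card - 1) = (d + 1) * (n - 1) := by
    intro x
    have hN : G.neighborFinset x = (L.filter (x ∈ ·)).biUnion fun M => M.erase x := by
      ext w
      simp only [mem_neighborFinset, Finset.mem_biUnion, Finset.mem_filter, Finset.mem_erase]
      constructor
      · intro h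
        obtain ⟨M, hM, h1, h2⟩ := hedge x w h
        exact ⟨M, ⟨hM, h1⟩, h.ne', h2⟩
      · rintro ⟨M, ⟨hM, h1⟩, h2, h3⟩
        exact ((hLmem M).1 hM).adj x h1 w h3 (Ne.symm h2)
    rw [← hk x, ← card_neighborFinset_eq_degree, hN, Finset.card_biUnion]
    · refine Finset.sum_congr rfl fun M hM => ?_
      rw [Finset.card_erase_of_mem (Finset.mem_filter.1 hM).2]
    · intro M hM N hN hMN
      rw [Finset.mem_coe, Finset.mem_filter] at hM hN
      refine Finset.disjoint_left.2 ?_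
      intro w hw1 hw2
      rw [Finset.mem_erase] at hw1 hw2
      exact hMN (huniq M hM.1 N hN.1 x w (Ne.symm hw1.1) hM.2 hw1.2 hN.2 hw2.2)
  -- By `hsize`, `d + 2` lines through `x` would need more neighbours than the degree allows; this
  -- is `hlines`.
  have hle : ∀ x, (L.filter (x ∈ ·)).card ≤ d + 1 := by
    intro x
    by_contra hcon
    have h1 : (L.filter (x ∈ ·)).card • (l + 1 - p ^ 2) ≤
        ∑ M ∈ L.filter (x ∈ ·), (M.card - 1) := by
      refine Finset.card_nsmul_le_sum _ _ _ fun M hM => ?_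
      have := hsize M (Finset.mem_filter.1 hM).1
      omega
    rw [hsum, smul_eq_mul] at h1
    have h2 : (d + 2) * (l + 1 - p ^ 2) ≤ (L.filter (x ∈ ·)).card * (l + 1 - p ^ 2) :=
      Nat.mul_le_mul_right _ (by omega)
    have h3 : (d + 2) * (l + 1) ≤ (d + 2) * (l + 1 - p ^ 2) + (d + 2) * p ^ 2 := by
      rw [← Nat.mul_add]
      exact Nat.mul_le_mul_left _ (by omega)
    omega
  have hMn : ∀ M ∈ L, M.card ≤ n := fun M hM => hclique M ((hLmem M).1 hM).adj
  -- At most `d + 1` summands, each at most `n - 1`, add up to `(d + 1) * (n - 1)`, so equality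
  -- holds throughout.
  have hall : ∀ x, (L.filter (x ∈ ·)).card = d + 1 ∧
      ∀ M ∈ L.filter (x ∈ ·), M.card - 1 = n - 1 := by
    intro x
    have h1 : ∑ M ∈ L.filter (x ∈ ·), (M.card - 1) ≤ ∑ M ∈ L.filter (x ∈ ·), (n - 1) :=
      Finset.sum_le_sum fun M hM => Nat.sub_le_sub_right (hMn M (Finset.mem_filter.1 hM).1) 1
    have h2 := hsum x
    have h3 := hle x
    have h4 : ∑ M ∈ L.filter (x ∈ ·), (n - 1) = (L.filter (x ∈ ·)).card * (n - 1) := by simp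
    have h5 : (L.filter (x ∈ ·)).card = d + 1 := by
      refine le_antisymm h3 ?_
      rw [h2, h4] at h1
      exact Nat.le_of_mul_le_mul_right h1 (by omega)
    refine ⟨h5, ?_⟩
    rw [h5, ← h2] at h4
    exact (Finset.sum_eq_sum_iff_of_le fun M hM =>
      Nat.sub_le_sub_right (hMn M (Finset.mem_filter.1 hM).1) 1).1 h4.symm
  refine ⟨L, fun M hM => ⟨?_, ((hLmem M).1 hM).adj⟩, huniq, hedge, fun x => (hall x).1⟩
  have hMc := ((hLmem M).1 hM).card
  obtain ⟨x, hx⟩ := Finset.card_pos.1 (show 0 < M.card by omega)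
  have := (hall x).2 M (Finset.mem_filter.2 ⟨hM, hx⟩)
  omega

end SimpleGraph

/-! ### Parameters of the graph of an array. -/

section Net

variable {ι V S : Type*}

/-- The graph on the columns of an array in which two columns are adjacent if they differ in every
row. -/
def disagreementGraph (A : ι → V → S) : SimpleGraph V where
  Adj c c' := c ≠ c' ∧ ∀ i, A i c ≠ A i c'
  symm := ⟨fun _ _ h => ⟨h.1.symm, fun i => (h.2 i).symm⟩⟩
  loopless := ⟨fun _ h => h.1 rfl⟩

variable [Fintype S] {n : ℕ} {A : ι → V → S}

theorem card_clique_disagreementGraph_le [Nonempty ι] (hS : Fintype.card S = n) (M : Finset V)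
    (hM : ∀ u ∈ M, ∀ v ∈ M, u ≠ v → (disagreementGraph A).Adj u v) : M.card ≤ n := by
  obtain ⟨i⟩ : Nonempty ι := inferInstance
  rw [← hS, ← Finset.card_univ]
  refine Finset.card_le_card_of_injOn (A i) (fun _ _ => Finset.mem_univ _) ?_
  intro u hu v hv huv
  by_contra hne
  exact (hM u hu v hv hne).2 i huv

variable [Fintype V]

theorem pair_bijective (hS : Fintype.card S = n) (hV : Fintype.card V = n ^ 2)
    (hA : ∀ i j, i ≠ j → Function.Injective fun c => (A i c, A j c)) {i j : ι} (hij : i ≠ j) :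
    Function.Bijective fun c => (A i c, A j c) := by
  rw [Fintype.bijective_iff_injective_and_card]
  exact ⟨hA i j hij, by rw [Fintype.card_prod, hS, hV, pow_two]⟩

variable [DecidableEq S]

theorem card_row_fiber [Nontrivial ι] (hS : Fintype.card S = n) (hV : Fintype.card V = n ^ 2)
    (hA : ∀ i j, i ≠ j → Function.Injective fun c => (A i c, A j c)) (i : ι) (a : S) :
    (Finset.univ.filter fun c => A i c = a).card = n := by
  obtain ⟨j, hj⟩ := exists_ne i
  have hb := pair_bijective hS hV hA hj.symm
  rw [← hS, ← Finset.card_univ]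
  refine Finset.card_bij (fun c _ => A j c) (fun _ _ => Finset.mem_univ _) ?_ ?_
  · intro c hc c' hc' h
    simp only [Finset.mem_filter, Finset.mem_univ, true_and] at hc hc'
    exact hb.1 (Prod.ext (hc.trans hc'.symm) h)
  · intro b _
    obtain ⟨c, hc⟩ := hb.2 (a, b)
    simp only [Prod.mk.injEq] at hc
    exact ⟨c, by simpa using hc.1, hc.2⟩

variable [Fintype ι] [DecidableEq ι] [DecidableEq V] [DecidableRel (disagreementGraph A).Adj]

/-- Among the `n` columns with entry `a` in row `i`, each of the other `m - 1` rows rules out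
exactly one, the column agreeing with `x` there. These are distinct because only `x` agrees with `x`
in two rows. -/
theorem card_neighbor_row_fiber [Nontrivial ι] {d : ℕ} (hd : Fintype.card ι + d = n)
    (hS : Fintype.card S = n) (hV : Fintype.card V = n ^ 2)
    (hA : ∀ i j, i ≠ j → Function.Injective fun c => (A i c, A j c)) (x : V) (i : ι) (a : S)
    (ha : A i x ≠ a) :
    (((disagreementGraph A).neighborFinset x).filter fun c => A i c = a).card = d + 1 := by
  have hex : ∀ j, i ≠ j → ∃ c, A i c = a ∧ A j c = A j x := by
    intro j hj
    obtain ⟨c, hc⟩ := (pair_bijective hS hV hA hj).2 (a, A j x)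
    simp only [Prod.mk.injEq] at hc
    exact ⟨c, hc⟩
  have : Nonempty V := ⟨x⟩
  choose! pt hpt1 hpt2 using hex
  have hsplit : (Finset.univ.filter fun c => A i c = a) =
      (((disagreementGraph A).neighborFinset x).filter fun c => A i c = a) ∪
        (Finset.univ.erase i).image pt := by
    ext c
    simp only [Finset.mem_filter, Finset.mem_univ, true_and, Finset.mem_union,
      SimpleGraph.mem_neighborFinset, Finset.mem_image, Finset.mem_erase, and_true]
    constructor
    · intro hc
      by_cases h : ∃ j, A j x = A j c
      · obtain ⟨j, hj⟩ := h
        have hij : i ≠ j := by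
          rintro rfl
          exact ha (hj.trans hc)
        refine Or.inr ⟨j, hij.symm, hA i j hij ?_⟩
        simp only [hpt1 j hij, hpt2 j hij, hc, hj]
      · push Not at h
        exact Or.inl ⟨⟨fun hxc => h i (by rw [hxc]), h⟩, hc⟩
    · rintro (h | ⟨j, hj, rfl⟩)
      · exact h.2
      · exact hpt1 j hj.symm
  have hdisj : Disjoint (((disagreementGraph A).neighborFinset x).filter fun c => A i c = a)
      ((Finset.univ.erase i).image pt) := by
    rw [Finset.disjoint_left]
    intro c hc hc'
    simp only [Finset.mem_filter, SimpleGraph.mem_neighborFinset] at hc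
    simp only [Finset.mem_image, Finset.mem_erase, Finset.mem_univ, and_true] at hc'
    obtain ⟨j, hj, rfl⟩ := hc'
    exact hc.1.2 j (hpt2 j hj.symm).symm
  have hinj : Set.InjOn pt (Finset.univ.erase i : Finset ι) := by
    intro j hj j' hj' h
    simp only [Finset.coe_erase, Finset.coe_univ, Set.mem_sdiff, Set.mem_univ, true_and,
      Set.mem_singleton_iff] at hj hj'
    by_contra hne
    have : pt j = x := hA j j' hne (by
      simp only [hpt2 j (Ne.symm hj)]
      rw [h, hpt2 j' (Ne.symm hj')])
    exact ha (this ▸ hpt1 j (Ne.symm hj))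
  have hc := card_row_fiber hS hV hA i a
  rw [hsplit, Finset.card_union_of_disjoint hdisj, Finset.card_image_of_injOn hinj,
    Finset.card_erase_of_mem (Finset.mem_univ _), Finset.card_univ] at hc
  have := Fintype.card_pos (α := ι)
  omega

theorem degree_disagreementGraph [Nontrivial ι] {d : ℕ} (hd : Fintype.card ι + d = n)
    (hS : Fintype.card S = n) (hV : Fintype.card V = n ^ 2)
    (hA : ∀ i j, i ≠ j → Function.Injective fun c => (A i c, A j c)) (x : V) :
    (disagreementGraph A).degree x = (d + 1) * (n - 1) := by
  obtain ⟨i⟩ : Nonempty ι := inferInstance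
  rw [← SimpleGraph.card_neighborFinset_eq_degree,
    Finset.card_eq_sum_card_fiberwise (f := A i) (t := Finset.univ.erase (A i x))]
  · rw [Finset.sum_congr rfl fun a ha => card_neighbor_row_fiber hd hS hV hA x i a
      (Finset.ne_of_mem_erase ha).symm]
    rw [Finset.sum_const, Finset.card_erase_of_mem (Finset.mem_univ _), Finset.card_univ, hS,
      smul_eq_mul, mul_comm]
  · intro c hc
    simp only [Finset.mem_coe, SimpleGraph.mem_neighborFinset] at hc
    simpa using (hc.2 i).symm

/-- Besides `y`, a neighbour of `x` that is not a neighbour of `y` agrees with `y` in exactly one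
row, and each row accounts for `d` of them. -/
theorem card_common_of_adj [Nontrivial ι] {d : ℕ} (hd : Fintype.card ι + d = n)
    (hS : Fintype.card S = n) (hV : Fintype.card V = n ^ 2)
    (hA : ∀ i j, i ≠ j → Function.Injective fun c => (A i c, A j c)) {x y : V}
    (hxy : (disagreementGraph A).Adj x y) :
    ((disagreementGraph A).neighborFinset x ∩ (disagreementGraph A).neighborFinset y).card +
      (Fintype.card ι * d + 1) = (d + 1) * (n - 1) := by
  set Z : ι → Finset V := fun i =>
    (((disagreementGraph A).neighborFinset x).filter fun c => A i c = A i y).erase y with hZ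
  have hZc : ∀ i, (Z i).card = d := by
    intro i
    rw [hZ, Finset.card_erase_of_mem, card_neighbor_row_fiber hd hS hV hA x i _ (hxy.2 i)]
    · rfl
    · simpa using hxy
  have hsd : (disagreementGraph A).neighborFinset x \ (disagreementGraph A).neighborFinset y =
      insert y (Finset.univ.biUnion Z) := by
    ext c
    simp only [hZ, Finset.mem_sdiff, SimpleGraph.mem_neighborFinset, Finset.mem_insert,
      Finset.mem_biUnion, Finset.mem_univ, true_and, Finset.mem_erase, Finset.mem_filter]
    constructor
    · rintro ⟨h1, h2⟩
      by_cases hcy : c = y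
      · exact Or.inl hcy
      right
      by_contra hcon
      push Not at hcon
      exact h2 ⟨Ne.symm hcy, fun i => (hcon i hcy h1).symm⟩
    · rintro (rfl | ⟨i, h1, h2, h3⟩)
      · exact ⟨hxy, SimpleGraph.irrefl _⟩
      · exact ⟨h2, fun h => h.2 i h3.symm⟩
  have h1 := Finset.card_sdiff_add_card_inter ((disagreementGraph A).neighborFinset x)
    ((disagreementGraph A).neighborFinset y)
  rw [hsd, Finset.card_insert_of_notMem (by simp [hZ]), Finset.card_biUnion,
    Finset.sum_congr rfl fun i _ => hZc i, Finset.sum_const, Finset.card_univ, smul_eq_mul,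
    SimpleGraph.card_neighborFinset_eq_degree, degree_disagreementGraph hd hS hV hA] at h1
  · omega
  · intro i _ j _ hij
    refine Finset.disjoint_left.2 fun c hc hc' => ?_
    simp only [hZ, Finset.mem_erase, Finset.mem_filter] at hc hc'
    exact hc.1 (hA i j hij (Prod.ext hc.2.2 hc'.2.2))

/-- The columns `x` and `y` agree in one row only. Each of the other `m - 1` rows contributes `d +
1` neighbours of `x` that agree with `y` there, and these are lost. -/
theorem card_common_of_not_adj [Nontrivial ι] {d : ℕ} (hd : Fintype.card ι + d = n)
    (hS : Fintype.card S = n) (hV : Fintype.card V = n ^ 2)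
    (hA : ∀ i j, i ≠ j → Function.Injective fun c => (A i c, A j c)) {x y : V} (hne : x ≠ y)
    (hxy : ¬ (disagreementGraph A).Adj x y) :
    ((disagreementGraph A).neighborFinset x ∩ (disagreementGraph A).neighborFinset y).card ≤
      (d + 1) * d := by
  obtain ⟨k, hk⟩ : ∃ k, A k x = A k y := by
    by_contra hcon
    push Not at hcon
    exact hxy ⟨hne, hcon⟩
  set Z : ι → Finset V := fun i =>
    ((disagreementGraph A).neighborFinset x).filter fun c => A i c = A i y with hZ
  have hZc : ∀ i ∈ Finset.univ.erase k, (Z i).card = d + 1 := by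
    intro i hi
    refine card_neighbor_row_fiber hd hS hV hA x i _ fun h => hne ?_
    exact hA i k (Finset.ne_of_mem_erase hi) (Prod.ext h hk)
  have hsd : (Finset.univ.erase k).biUnion Z ⊆
      (disagreementGraph A).neighborFinset x \ (disagreementGraph A).neighborFinset y := by
    intro c hc
    simp only [hZ, Finset.mem_biUnion, Finset.mem_filter] at hc
    obtain ⟨i, -, h1, h2⟩ := hc
    rw [Finset.mem_sdiff]
    refine ⟨h1, fun h => ?_⟩
    rw [SimpleGraph.mem_neighborFinset] at h
    exact h.2 i h2.symm
  have h1 := Finset.card_sdiff_add_card_inter ((disagreementGraph A).neighborFinset x)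
    ((disagreementGraph A).neighborFinset y)
  have h2 := Finset.card_le_card hsd
  rw [Finset.card_biUnion, Finset.sum_congr rfl hZc, Finset.sum_const,
    Finset.card_erase_of_mem (Finset.mem_univ _), Finset.card_univ, smul_eq_mul] at h2
  · rw [SimpleGraph.card_neighborFinset_eq_degree, degree_disagreementGraph hd hS hV hA] at h1
    have h3 := Fintype.card_pos (α := ι)
    have h4 : n - 1 = (Fintype.card ι - 1) + d := by omega
    rw [h4] at h1
    nlinarith
  · intro i _ j _ hij
    refine Finset.disjoint_left.2 fun c hc hc' => ?_
    simp only [hZ, Finset.mem_filter, SimpleGraph.mem_neighborFinset] at hc hc'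
    have : c = y := hA i j hij (Prod.ext hc.2 hc'.2)
    exact hxy (this ▸ hc.1)

/-! ### From lines to a parallel class. -/

/-- A vertex outside a clique that meets every line of the net has exactly `d` neighbours in it. -/
theorem card_neighbor_clique {d : ℕ} (hd : Fintype.card ι + d = n)
    (hS : Fintype.card S = n)
    (hA : ∀ i j, i ≠ j → Function.Injective fun c => (A i c, A j c)) {C : Finset V}
    (hC : ∀ u ∈ C, ∀ v ∈ C, u ≠ v → (disagreementGraph A).Adj u v) (hCn : C.card = n) {x : V}
    (hx : x ∉ C) : (C ∩ (disagreementGraph A).neighborFinset x).card = d := by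
  have hinj : ∀ i, Set.InjOn (A i) C := by
    intro i u hu v hv huv
    by_contra hne
    exact (hC u hu v hv hne).2 i huv
  have himage : ∀ i, C.image (A i) = Finset.univ := by
    intro i
    rw [← Finset.card_eq_iff_eq_univ, Finset.card_image_of_injOn (hinj i), hCn, hS]
  have hex : ∀ i, ∃ c ∈ C, A i c = A i x := by
    intro i
    have := Finset.mem_univ (A i x)
    rw [← himage i, Finset.mem_image] at this
    exact this
  choose pt hpt1 hpt2 using hex
  -- Every row takes each value exactly once on `C`, so the non-neighbours of `x` in `C` are one per
  -- row.
  have hsd : C \ (disagreementGraph A).neighborFinset x = Finset.univ.image pt := by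
    ext c
    simp only [Finset.mem_sdiff, SimpleGraph.mem_neighborFinset, Finset.mem_image,
      Finset.mem_univ, true_and]
    constructor
    · rintro ⟨h1, h2⟩
      by_contra hcon
      push Not at hcon
      refine h2 ⟨fun h => hx (h ▸ h1), fun i hi => hcon i ?_⟩
      exact hinj i (hpt1 i) h1 ((hpt2 i).trans hi)
    · rintro ⟨i, rfl⟩
      exact ⟨hpt1 i, fun h => h.2 i (hpt2 i).symm⟩
  have hptinj : Function.Injective pt := by
    intro i j hij
    by_contra hne
    have : pt i = x := hA i j hne (Prod.ext (hpt2 i) (by simp only [hij, hpt2 j]))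
    exact hx (this ▸ hpt1 i)
  have h1 := Finset.card_sdiff_add_card_inter C ((disagreementGraph A).neighborFinset x)
  rw [hsd, Finset.card_image_of_injective _ hptinj, Finset.card_univ, hCn] at h1
  omega

/-- A system of cliques of size `n` as in the conclusion of `SimpleGraph.exists_net_lines` contains
a parallel class, which gives a further row of the array. -/
theorem exists_row_of_lines {d : ℕ} (hn : 0 < n) (hd : Fintype.card ι + d = n)
    (hS : Fintype.card S = n) (hV : Fintype.card V = n ^ 2)
    (hA : ∀ i j, i ≠ j → Function.Injective fun c => (A i c, A j c))
    (L : Finset (Finset V))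
    (hL : ∀ M ∈ L, M.card = n ∧ ∀ u ∈ M, ∀ v ∈ M, u ≠ v → (disagreementGraph A).Adj u v)
    (huniq : ∀ M ∈ L, ∀ N ∈ L, ∀ u v, u ≠ v → u ∈ M → v ∈ M → u ∈ N → v ∈ N → M = N)
    (hedge : ∀ u v, (disagreementGraph A).Adj u v → ∃ M ∈ L, u ∈ M ∧ v ∈ M)
    (hthrough : ∀ x, (L.filter (x ∈ ·)).card = d + 1) :
    ∃ r : V → S, ∀ i c c', A i c = A i c' → r c = r c' → c = c' := by
  obtain ⟨x₀⟩ : Nonempty V := Fintype.card_pos_iff.1 (by rw [hV]; positivity)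
  obtain ⟨C, hC⟩ : ∃ C, C ∈ L.filter (x₀ ∈ ·) :=
    Finset.card_pos.1 (by rw [hthrough]; omega)
  have hCL := (Finset.mem_filter.1 hC).1
  have hpar : ∀ x, ∃ M ∈ L, (M = C ∨ Disjoint M C) ∧ x ∈ M ∧
      ∀ N ∈ L, (N = C ∨ Disjoint N C) → x ∈ N → N = M := by
    intro x
    by_cases hx : x ∈ C
    · refine ⟨C, hCL, Or.inl rfl, hx, fun N _ hN hxN => hN.resolve_right fun h => ?_⟩
      exact Finset.disjoint_left.1 h hxN hx
    · choose! ln hln1 hln2 hln3 using hedge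
      -- Joining `x` to its `d` neighbours on `C` is a bijection onto the lines through `x` that
      -- meet `C`.
      have hmeet : ((L.filter (x ∈ ·)).filter fun N => ¬ Disjoint N C).card = d := by
        rw [← card_neighbor_clique hd hS hA (hL C hCL).2 (hL C hCL).1 hx]
        symm
        refine Finset.card_bij (fun w _ => ln x w) ?_ ?_ ?_
        · intro w hw
          simp only [Finset.mem_inter, SimpleGraph.mem_neighborFinset] at hw
          rw [Finset.mem_filter, Finset.mem_filter]
          exact ⟨⟨hln1 x w hw.2, hln2 x w hw.2⟩,
            fun h => Finset.disjoint_left.1 h (hln3 x w hw.2) hw.1⟩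
        · intro w hw w' hw' h
          simp only [Finset.mem_inter, SimpleGraph.mem_neighborFinset] at hw hw'
          by_contra hne
          have := huniq _ hCL _ (hln1 x w hw.2) w w' hne hw.1 hw'.1 (hln3 x w hw.2)
            (h ▸ hln3 x w' hw'.2)
          exact hx (this ▸ hln2 x w hw.2)
        · intro N hN
          rw [Finset.mem_filter, Finset.mem_filter] at hN
          obtain ⟨⟨hNL, hxN⟩, hNC⟩ := hN
          obtain ⟨w, hwN, hwC⟩ := Finset.not_disjoint_iff.1 hNC
          have hxw : x ≠ w := fun h => hx (h ▸ hwC)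
          have hadj := (hL N hNL).2 x hxN w hwN hxw
          refine ⟨w, Finset.mem_inter.2 ⟨hwC, by simpa using hadj⟩, ?_⟩
          exact huniq _ (hln1 x w hadj) _ hNL x w hxw (hln2 x w hadj) (hln3 x w hadj) hxN hwN
      have hmiss : ((L.filter (x ∈ ·)).filter fun N => Disjoint N C).card = 1 := by
        have := Finset.card_filter_add_card_filter_not (s := L.filter (x ∈ ·))
          (fun N => Disjoint N C)
        rw [hmeet, hthrough] at this
        omega
      obtain ⟨M, hM⟩ := Finset.card_eq_one.1 hmiss
      have hMm : ∀ N, (N ∈ L ∧ x ∈ N) ∧ Disjoint N C ↔ N = M := by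
        intro N
        rw [← Finset.mem_singleton, ← hM, Finset.mem_filter, Finset.mem_filter]
      obtain ⟨⟨h1, h2⟩, h3⟩ := (hMm M).2 rfl
      refine ⟨M, h1, Or.inr h3, h2, fun N hN hNC hxN => (hMm N).1 ⟨⟨hN, hxN⟩, ?_⟩⟩
      exact hNC.resolve_left fun h => hx (h ▸ hxN)
  choose f hf1 hf2 hf3 hf4 using hpar
  have hfib : ∀ x y, y ∈ f x → f y = f x := fun x y hy =>
    (hf4 y (f x) (hf1 x) (hf2 x) hy).symm
  -- The fibres of `f` are lines of size `n` partitioning `n ^ 2` columns, so the parallel class can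
  -- be labelled by `S`.
  have hT : (Finset.univ.image f).card = n := by
    have h1 := Finset.card_eq_sum_card_image f (Finset.univ : Finset V)
    have h2 : ∀ N ∈ Finset.univ.image f, (Finset.univ.filter fun x => f x = N).card = n := by
      intro N hN
      obtain ⟨x, -, rfl⟩ := Finset.mem_image.1 hN
      rw [← (hL (f x) (hf1 x)).1]
      congr 1
      ext y
      simp only [Finset.mem_filter, Finset.mem_univ, true_and]
      exact ⟨fun h => h ▸ hf3 y, hfib x y⟩
    rw [Finset.sum_congr rfl h2, Finset.sum_const, Finset.card_univ, hV, smul_eq_mul, pow_two] at h1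
    exact (Nat.eq_of_mul_eq_mul_right hn h1).symm
  obtain ⟨e⟩ : Nonempty ({M // M ∈ Finset.univ.image f} ≃ S) :=
    Fintype.card_eq.1 (by rw [Fintype.card_coe, hT, hS])
  refine ⟨fun x => e ⟨f x, Finset.mem_image_of_mem _ (Finset.mem_univ _)⟩, ?_⟩
  intro i c c' hi hr
  have hff : f c = f c' := by simpa using hr
  by_contra hne
  exact ((hL (f c) (hf1 c)).2 c (hf3 c) c' (hff ▸ hf3 c') hne).2 i hi

end Net

/-! ### Numerical conditions and the existence of a further row. -/

/-- To leading order the first condition asks for `n > 2pd²` and the second for `n > p²d² / (2(p -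
d))`. They balance at `p = 4d/3`, where both read `n > 8d³/3`; the third is weaker. -/
theorem net_parameter_bounds {n d l m : ℕ} (hn : 2 ≤ n) (hmd : m + d = n)
    (hl : l + (m * d + 1) = (d + 1) * (n - 1))
    (hbound : 8 * d ^ 3 + 8 * d ^ 2 < 3 * n + 2 * d) :
    (2 * (4 * d / 3) + 1) * ((d + 1) * d - 1) < l + 1 ∧
    2 * ((d + 1) * (n - 1)) + (4 * d / 3 + 2) * (4 * d / 3 + 1) * ((d + 1) * d - 1) <
      2 * (4 * d / 3 + 2) * (l + 1) ∧
    (d + 1) * (n - 1) + (d + 2) * (4 * d / 3) ^ 2 < (d + 2) * (l + 1) := by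
  obtain ⟨N, rfl⟩ : ∃ N, n = N + 1 := ⟨n - 1, by omega⟩
  simp only [Nat.add_sub_cancel] at *
  -- For `d = 0` the subtraction `(d + 1) * d - 1` truncates.
  rcases Nat.eq_zero_or_pos d with rfl | hd
  · simp at *; omega
  obtain ⟨q, hq⟩ : ∃ q, (d + 1) * d = q + 1 := ⟨(d + 1) * d - 1, by
    have : 0 < (d + 1) * d := by positivity
    omega⟩
  have hl' : l + 1 + d = N + d ^ 2 := by
    have : m = N + 1 - d := by omega
    zify [show d ≤ N + 1 by omega] at *
    rw [this] at hl
    nlinarith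
  rw [hq, Nat.add_sub_cancel]
  zify at hq hl' hbound hd
  have hq' : (q : ℤ) = d ^ 2 + d - 1 := by linarith
  have hl'' : (l : ℤ) = N + d ^ 2 - d - 1 := by linarith
  obtain ⟨e, he⟩ : ∃ e, d = 3 * e ∨ d = 3 * e + 1 ∨ d = 3 * e + 2 := ⟨d / 3, by omega⟩
  rcases he with rfl | rfl | rfl
  · have hp : 4 * (3 * e) / 3 = 4 * e := by omega
    rw [hp]
    zify
    rw [hq', hl'']
    push_cast at *
    have he : (1 : ℤ) ≤ e := by omega
    obtain ⟨f, rfl⟩ : ∃ f, e = f + 1 := ⟨e - 1, by omega⟩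
    push_cast at *
    have hf : (0 : ℤ) ≤ f := by positivity
    have h2 := pow_nonneg hf 2
    have h3 := pow_nonneg hf 3
    have h4 := pow_nonneg hf 4
    have h5 := mul_le_mul_of_nonneg_left hbound.le hf
    refine ⟨?_, ?_, ?_⟩ <;> nlinarith
  · have hp : 4 * (3 * e + 1) / 3 = 4 * e + 1 := by omega
    rw [hp]
    zify
    rw [hq', hl'']
    push_cast at *
    have hf : (0 : ℤ) ≤ e := by positivity
    have h2 := pow_nonneg hf 2
    have h3 := pow_nonneg hf 3
    have h4 := pow_nonneg hf 4
    have h5 := mul_le_mul_of_nonneg_left hbound.le hf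
    refine ⟨?_, ?_, ?_⟩ <;> nlinarith
  · have hp : 4 * (3 * e + 2) / 3 = 4 * e + 2 := by omega
    rw [hp]
    zify
    rw [hq', hl'']
    push_cast at *
    have hf : (0 : ℤ) ≤ e := by positivity
    have h2 := pow_nonneg hf 2
    have h3 := pow_nonneg hf 3
    have h4 := pow_nonneg hf 4
    have h5 := mul_le_mul_of_nonneg_left hbound.le hf
    refine ⟨?_, ?_, ?_⟩ <;> nlinarith

/-- An orthogonal array of small positive deficiency has a further row. -/
theorem exists_row_of_bound {V S : Type*} [Fintype V] [Fintype S] {m n d : ℕ} (hm : 2 ≤ m)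
    (hmd : m + d = n) (hbound : 8 * d ^ 3 + 8 * d ^ 2 < 3 * n + 2 * d)
    {A : Fin m → V → S} (hS : Fintype.card S = n) (hV : Fintype.card V = n ^ 2)
    (hA : ∀ i j, i ≠ j → Function.Injective fun c => (A i c, A j c)) :
    ∃ r : V → S, ∀ i c c', A i c = A i c' → r c = r c' → c = c' := by
  classical
  have : Nontrivial (Fin m) := Fin.nontrivial_iff_two_le.2 hm
  have hn : 2 ≤ n := by omega
  have hd : Fintype.card (Fin m) + d = n := by rw [Fintype.card_fin, hmd]
  obtain ⟨l, hl, hlm⟩ : ∃ l, (∀ x y, (disagreementGraph A).Adj x y →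
      ((disagreementGraph A).neighborFinset x ∩ (disagreementGraph A).neighborFinset y).card = l) ∧
      ((∃ x y, (disagreementGraph A).Adj x y) → l + (m * d + 1) = (d + 1) * (n - 1)) := by
    refine ⟨(d + 1) * (n - 1) - (m * d + 1), fun x y hxy => ?_, ?_⟩
    · have := card_common_of_adj hd hS hV hA hxy
      rw [Fintype.card_fin] at this
      omega
    · rintro ⟨x, y, hxy⟩
      have := card_common_of_adj hd hS hV hA hxy
      rw [Fintype.card_fin] at this
      omega
  -- An edge, which exists because the degree is positive, shows that the subtraction defining `l`
  -- does not truncate.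
  have hl' : l + (m * d + 1) = (d + 1) * (n - 1) := by
    apply hlm
    obtain ⟨x⟩ : Nonempty V := Fintype.card_pos_iff.1 (by rw [hV]; positivity)
    have hdeg := degree_disagreementGraph hd hS hV hA x
    rw [← SimpleGraph.card_neighborFinset_eq_degree] at hdeg
    have hpos : 0 < (d + 1) * (n - 1) := Nat.mul_pos (by omega) (by omega)
    obtain ⟨y, hy⟩ := Finset.card_pos.1 (hdeg ▸ hpos)
    exact ⟨x, y, by simpa using hy⟩
  obtain ⟨h1, h2, h3⟩ := net_parameter_bounds hn hmd hl' hbound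
  obtain ⟨L, hL, huniq, hedge, hthrough⟩ := (disagreementGraph A).exists_net_lines hn
    (degree_disagreementGraph hd hS hV hA) hl
    (fun x y hne hxy => (card_common_of_not_adj hd hS hV hA hne hxy).trans (by omega))
    (card_clique_disagreementGraph_le hS) h1 h2 h3
  exact exists_row_of_lines (by omega) hd hS hV hA L hL huniq hedge hthrough

/-- The columns other than `x` that agree with `x` in row `i` number `n - 1`, and for different rows
they are disjoint; they lie among `n ^ 2 - 1` columns. -/
theorem card_rows_le {ι V S : Type*} [Fintype ι] [Fintype V] [Fintype S] [Nontrivial ι] {n : ℕ}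
    (hn : 2 ≤ n) {A : ι → V → S} (hS : Fintype.card S = n) (hV : Fintype.card V = n ^ 2)
    (hA : ∀ i j, i ≠ j → Function.Injective fun c => (A i c, A j c)) :
    Fintype.card ι ≤ n + 1 := by
  classical
  obtain ⟨x⟩ : Nonempty V := Fintype.card_pos_iff.1 (by rw [hV]; positivity)
  have h1 : (Finset.univ.biUnion fun i => (Finset.univ.filter fun c => A i c = A i x).erase x).card
      ≤ (Finset.univ.erase x).card :=
    Finset.card_le_card fun c hc => by
      simp only [Finset.mem_biUnion, Finset.mem_erase] at hc
      obtain ⟨i, -, h, -⟩ := hc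
      simpa using h
  rw [Finset.card_biUnion, Finset.sum_congr rfl fun i _ => by
      rw [Finset.card_erase_of_mem (by simp), card_row_fiber hS hV hA],
    Finset.sum_const, Finset.card_univ, smul_eq_mul, Finset.card_erase_of_mem (Finset.mem_univ _),
    Finset.card_univ, hV] at h1
  · obtain ⟨N, rfl⟩ : ∃ N, n = N + 1 := ⟨n - 1, by omega⟩
    have h2 : (N + 1) ^ 2 - 1 = (N + 2) * N := by
      rw [Nat.sub_eq_iff_eq_add (Nat.one_le_pow _ _ (by omega))]
      ring
    rw [h2, Nat.add_sub_cancel] at h1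
    exact Nat.le_of_mul_le_mul_right h1 (by omega)
  · intro i _ j _ hij
    refine Finset.disjoint_left.2 fun c hc hcj => ?_
    simp only [Finset.mem_erase, Finset.mem_filter] at hc hcj
    exact hc.1 (hA i j hij (Prod.ext hc.2.2 hcj.2.2))

/-! ### Appending rows and the induction on `d`. -/

/-- The array obtained by appending a row. -/
def appendRow {m : ℕ} {V S : Type*} (A : Matrix (Fin m) V S) (r : V → S) :
    Matrix (Fin (m + 1)) V S :=
  Fin.snoc (α := fun _ => V → S) A r

theorem appendRow_castSucc {m : ℕ} {V S : Type*} (A : Matrix (Fin m) V S) (r : V → S) (i : Fin m)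
    (c : V) : appendRow A r i.castSucc c = A i c :=
  congrFun (Fin.snoc_castSucc (α := fun _ => V → S) r A i) c

theorem appendRow_last {m : ℕ} {V S : Type*} (A : Matrix (Fin m) V S) (r : V → S) (c : V) :
    appendRow A r (Fin.last m) c = r c :=
  congrFun (Fin.snoc_last (α := fun _ => V → S) r A) c

theorem ExtendsToFull.of_appendRow {S : Type*} [Fintype S] {m n : ℕ}
    {A : Matrix (Fin m) (Fin (n ^ 2)) S} {r : Fin (n ^ 2) → S}
    (h : ExtendsToFull (m + 1) n (appendRow A r)) :
    ExtendsToFull m n A := by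
  obtain ⟨hm, B, hB, hBA⟩ := h
  refine ⟨by omega, B, hB, fun i c => ?_⟩
  have := hBA i.castSucc c
  rw [appendRow_castSucc] at this
  exact this

theorem IsOrthogonalArray.appendRow {S : Type*} [Fintype S] {m n : ℕ}
    {A : Matrix (Fin m) (Fin (n ^ 2)) S} (hA : IsOrthogonalArray m n A) {r : Fin (n ^ 2) → S}
    (hr : ∀ i c c', A i c = A i c' → r c = r c' → c = c') :
    IsOrthogonalArray (m + 1) n (appendRow A r) := by
  refine ⟨hA.1, fun i j => ?_⟩
  induction i using Fin.lastCases with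
  | last =>
    induction j using Fin.lastCases with
    | last => exact fun h => absurd rfl h
    | cast j =>
      intro _ c c' h
      simp only [appendRow_last, appendRow_castSucc, Prod.mk.injEq] at h
      exact hr j c c' h.2 h.1
  | cast i =>
    induction j using Fin.lastCases with
    | last =>
      intro _ c c' h
      simp only [appendRow_last, appendRow_castSucc, Prod.mk.injEq] at h
      exact hr i c c' h.1 h.2
    | cast j =>
      intro hij c c' h
      simp only [appendRow_castSucc] at h
      exact hA.2 i j (fun h => hij (h ▸ rfl)) h

theorem extendsToFull_of_card_rows_eq {S : Type*} [Fintype S] {m n : ℕ} (hmn : m = n + 1)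
    {A : Matrix (Fin m) (Fin (n ^ 2)) S} (hA : IsOrthogonalArray m n A) : ExtendsToFull m n A := by
  subst hmn
  exact ⟨le_rfl, A, hA, fun _ _ => rfl⟩

theorem extendsToFull_of_bound {S : Type*} [Fintype S] {n : ℕ} (d : ℕ) :
    ∀ {m : ℕ} (_ : 2 ≤ m) (_ : m + d = n) (_ : 8 * d ^ 3 + 8 * d ^ 2 < 3 * n + 2 * d)
    {A : Matrix (Fin m) (Fin (n ^ 2)) S}, IsOrthogonalArray m n A → ExtendsToFull m n A := by
  induction d with
  | zero =>
    intro m hm hmd hbound A hA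
    obtain ⟨r, hr⟩ := exists_row_of_bound hm hmd hbound hA.1 (Fintype.card_fin _) hA.2
    exact (extendsToFull_of_card_rows_eq (by omega) (hA.appendRow hr)).of_appendRow
  | succ d ih =>
    intro m hm hmd hbound A hA
    obtain ⟨r, hr⟩ := exists_row_of_bound hm hmd hbound hA.1 (Fintype.card_fin _) hA.2
    refine (ih (by omega) (by omega) ?_ (hA.appendRow hr)).of_appendRow
    -- For fixed `n` the bound weakens as `d` decreases, so it survives the new row.
    nlinarith

theorem corollaryA1 {S : Type*} [Fintype S] (m n : ℕ) (hm : 0 < m) (hn : 0 < n)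
    (hone : n = 1 → m ≤ 2)
    (A : Matrix (Fin m) (Fin (n ^ 2)) S) (hA : IsOrthogonalArray m n A)
    (δ : ℤ) (hδ : δ = (n : ℤ) - (m : ℤ) + 1)
    (hbound : (n : ℝ) > 8 / 3 * (δ : ℝ) ^ 3 - 16 / 3 * (δ : ℝ) ^ 2 + 2 * (δ : ℝ) + 2 / 3) :
    ExtendsToFull m n A := by
  rcases Nat.lt_or_ge (n + 1) m with hlt | hle
  · exfalso
    have hn2 : 2 ≤ n := by
      by_contra hcon
      have := hone (by omega)
      omega
    have : Nontrivial (Fin m) := Fin.nontrivial_iff_two_le.2 (by omega)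
    have := card_rows_le hn2 hA.1 (Fintype.card_fin _) hA.2
    rw [Fintype.card_fin] at this
    omega
  rcases Nat.eq_or_lt_of_le hle with heq | hlt
  · exact extendsToFull_of_card_rows_eq heq hA
  obtain ⟨d, hd⟩ : ∃ d, n = m + d := ⟨n - m, by omega⟩
  have hbound' : 8 * d ^ 3 + 8 * d ^ 2 < 3 * n + 2 * d := by
    have hδ' : (δ : ℝ) = d + 1 := by
      rw [hδ, hd]
      push_cast
      ring
    rw [hδ'] at hbound
    have : (8 * d ^ 3 + 8 * d ^ 2 : ℝ) < 3 * n + 2 * d := by nlinarith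
    exact_mod_cast this
  rcases Nat.lt_or_ge m 2 with hm2 | hm2
  · obtain rfl : m = 1 := by omega
    -- With a single row `n = d + 1`, and the bound fails for every `d ≥ 1`. This leaves `n = 1`,
    -- with one column, where the row can be repeated.
    have hd0 : d = 0 := by
      by_contra hcon
      have : 1 ≤ d := by omega
      nlinarith [Nat.pow_le_pow_left this 2, Nat.pow_le_pow_left this 3]
    obtain rfl : n = 1 := by omega
    have hr : ∀ (i : Fin 1) (c c' : Fin (1 ^ 2)), A i c = A i c' → A 0 c = A 0 c' → c = c' :=
      fun _ c c' _ _ => Subsingleton.elim (α := Fin 1) c c'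
    exact (extendsToFull_of_card_rows_eq rfl (hA.appendRow hr)).of_appendRow
  · exact extendsToFull_of_bound d hm2 hd.symm hbound' hA
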